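/- Let $\Omega\subset\mathbb{R}^d$ be a nonempty compact set on which Lebesgue measure has full support (every nonempty relatively open subset of $\Omega$ has positive Lebesgue measure), and let $K:\Omega\times\Omega\to\mathbb{R}$ be a continuous, symmetric, (strictly) positive definite kernel with native space $\mathcal H$, i.e. the Hilbert space of functions on $\Omega$ with reproducing kernel $K$. For a closed subspace $U\subseteq\mathcal H$ let $\Pi_U$ be the $\mathcal H$-orthogonal projector onto $U$, and let $$P_U(x)=\sup_{\|f\|_{\mathcal H}\le 1}|f(x)-(\Pi_Uf)(x)|,\qquad K_U(x,y)=\Pi_U^x\Pi_U^yK(x,y)$$ be its power function and its kernel. Let $\lambda_1\ge\lambda_2\ge\dots$ be the positive eigenvalues, repeated according to multiplicity, of the integral operator $Tf(x)=\int_\Omega K(x,y)f(y)\,dy$ on $L_2(\Omega)$, and for a closed subspace $V\subseteq\mathcal H$ let $\lambda_{1,V}\ge\lambda_{2,V}\ge\dots$ be those of $T_Vf(x)=\int_\Omega K_V(x,y)f(y)\,dy$ (both sequences are continued by $0$ if there are only finitely many). For $n\le\dim V$ write $E_{n,V}=\operatorname{span}\{\sqrt{\lambda_{j,V}}\,\varphi_{j,V}: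 1\le j\le n\}\subseteq\mathcal H$, where the $\varphi_{j,V}$ are $L_2(\Omega)$-orthonormal eigenfunctions, $T_V\varphi_{j,V}=\lambda_{j,V}\varphi_{j,V}$; such eigenfunctions exist, and they are determined up to the choice of an orthonormal basis in each eigenspace of $T_V$. Let $V\subseteq\mathcal H$ be a closed subspace. Then $\sum_j\lambda_j$ and $\sum_j\lambda_{j,V}$ converge, and for every integer $0\le n\le\dim V$ we have $\sum_{j\le n}\lambda_{j,V}\le\sum_j\lambda_j$ and every $n$-dimensional subspace $V_n\subseteq V$ satisfies $$\|P_{V_n}\|_{L_2(\Omega)}\ \ge\ \sqrt{\sum_{j}\lambda_j-\sum_{j=1}^{n}\lambda_{j,V}}.$$ Every $E_{n,V}$ is an $n$-dimensional subspace of $V$, and equality holds if and only if $V_n$ is a space $E_{n,V}$ for some choice of the eigenfunctions $\varphi_{1,V},\dots,\varphi_{n,V}$; if $n=0$ or $\lambda_{n+1,V}<\lambda_{n,V}$, then $E_{n,V}$ does not depend on the choice, so that it is the unique optimal subspace. Moreover $\sum_{1\le j\le\dim V}\lambda_{j,V}\le\sum_j\lambda_j$ and $$\|P_V\|_{L_2(\Omega)}=\sqrt{\sum_{j}\lambda_j-\sum_{1\le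 j\le\dim V}\lambda_{j,V}}.$$ -/

import Mathlib

open MeasureTheory

noncomputable section

/-- Lebesgue measure of `ℝᵈ` on the subset `Ω`, as a measure on the subtype `Ω`. -/
abbrev lebesgueOn {d : ℕ} (Ω : Set (EuclideanSpace ℝ (Fin d))) : Measure Ω :=
  (volume : Measure (EuclideanSpace ℝ (Fin d))).comap Subtype.val

instance isFiniteMeasure_lebesgueOn {d : ℕ} (Ω : Set (EuclideanSpace ℝ (Fin d)))
    [CompactSpace Ω] : IsFiniteMeasure (lebesgueOn Ω) := by
  have hΩ : IsCompact Ω := isCompact_iff_compactSpace.mpr inferInstance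
  refine ⟨?_⟩
  rw [comap_subtype_coe_apply hΩ.measurableSet]
  simpa using hΩ.measure_lt_top

section IntegralOperator

variable {X : Type*} [TopologicalSpace X] [CompactSpace X]
  [MeasurableSpace X] [BorelSpace X] (μ : Measure X) [IsFiniteMeasure μ]

theorem integrable_kernel_mul (k : C(X × X, ℝ)) (f : Lp ℝ 2 μ) (x : X) :
    Integrable (fun y => k (x, y) * f y) μ := by
  have hf : Integrable f μ := (Lp.memLp f).integrable (by norm_num)
  refine hf.bdd_mul (c := ‖k‖) ?_ ?_
  · exact (k.continuous.comp (by fun_prop : Continuous fun y : X => (x, y))).aestronglyMeasurable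
  · exact Filter.Eventually.of_forall fun y => k.norm_coe_le_norm _

variable [FirstCountableTopology X]

theorem continuous_integral_kernel_mul (k : C(X × X, ℝ)) (f : Lp ℝ 2 μ) :
    Continuous (fun x => ∫ y, k (x, y) * f y ∂μ) := by
  have hf : Integrable f μ := (Lp.memLp f).integrable (by norm_num)
  refine continuous_of_dominated (bound := fun y => ‖k‖ * ‖f y‖)
    (fun x => (integrable_kernel_mul μ k f x).aestronglyMeasurable) ?_ (hf.norm.const_mul _) ?_
  · intro x
    refine Filter.Eventually.of_forall fun y => ?_
    rw [norm_mul]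
    exact mul_le_mul_of_nonneg_right (k.norm_coe_le_norm _) (norm_nonneg _)
  · exact Filter.Eventually.of_forall fun y => by fun_prop

theorem memLp_integral_kernel_mul (k : C(X × X, ℝ)) (f : Lp ℝ 2 μ) :
    MemLp (fun x => ∫ y, k (x, y) * f y ∂μ) 2 μ := by
  let g : C(X, ℝ) := ⟨_, continuous_integral_kernel_mul μ k f⟩
  exact MemLp.of_bound (continuous_integral_kernel_mul μ k f).aestronglyMeasurable ‖g‖
    (Filter.Eventually.of_forall fun x => g.norm_coe_le_norm x)

/-- The integral operator `f ↦ ∫ k(·, y) f(y) dμ(y)` on `L₂(μ)` of a continuous kernel `k`. -/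
def integralOperator (k : C(X × X, ℝ)) : Lp ℝ 2 μ →ₗ[ℝ] Lp ℝ 2 μ where
  toFun f := (memLp_integral_kernel_mul μ k f).toLp _
  map_add' f g := by
    rw [← MemLp.toLp_add]
    congr 1
    funext x
    rw [Pi.add_apply, ← integral_add (integrable_kernel_mul μ k f x)
      (integrable_kernel_mul μ k g x)]
    refine integral_congr_ae ?_
    filter_upwards [Lp.coeFn_add f g] with y hy
    rw [hy, Pi.add_apply, mul_add]
  map_smul' c f := by
    rw [RingHom.id_apply, ← MemLp.toLp_const_smul]
    congr 1
    funext x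
    rw [Pi.smul_apply, ← integral_smul]
    refine integral_congr_ae ?_
    filter_upwards [Lp.coeFn_smul c f] with y hy
    rw [hy, Pi.smul_apply, smul_eq_mul, smul_eq_mul]
    ring

end IntegralOperator

/-- The positive eigenvalues of `T` in decreasing order, repeated according to multiplicity and
numbered from `0`: the `j`-th one is the largest `t > 0` such that more than `j` eigenvalues,
counted with multiplicity, are `≥ t`. The value is `0` when there are at most `j` positive
eigenvalues. -/
def orderedEigenvalue {E : Type*} [AddCommGroup E] [Module ℝ E] (T : E →ₗ[ℝ] E) (j : ℕ) : ℝ :=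
  sSup {t : ℝ | 0 < t ∧
    (j : Cardinal) < Module.rank ℝ ↥(⨆ (s : ℝ) (_ : t ≤ s), Module.End.eigenspace T s)}

section NativeSpace

variable {X : Type*} {H : Type*} [NormedAddCommGroup H] [InnerProductSpace ℝ H]
  [RKHS ℝ H X ℝ]

/-- The power function of the `H`-orthogonal projector `Π` onto `V`: its value at `x` is the norm
`sup {|f(x) - (Π f)(x)| : ‖f‖ ≤ 1}` of the error functional at `x`. -/
def powerFunction (V : Submodule ℝ H) [V.HasOrthogonalProjection] (x : X) : ℝ :=
  ⨆ f : {f : H // ‖f‖ ≤ 1}, |f.1 x - V.starProjection f.1 x|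

variable [CompleteSpace H]

/-- `H` is the native space of `K`: the Hilbert space of functions on `X` whose reproducing
kernel is `K`. -/
structure IsNativeSpace [TopologicalSpace X] (K : C(X × X, ℝ)) (H : Type*) [NormedAddCommGroup H]
    [InnerProductSpace ℝ H] [CompleteSpace H] [RKHS ℝ H X ℝ] : Prop where
  kernel_eq : ∀ x y, RKHS.kernel H x y 1 = K (x, y)

/-- The kernel translate `K(·, y)` as an element of the native space. -/
def kernelTranslate (H : Type*) [NormedAddCommGroup H] [InnerProductSpace ℝ H] [CompleteSpace H]
    [RKHS ℝ H X ℝ] (y : X) : H := RKHS.kerFun H y (1 : ℝ)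

/-- The function `(x, y) ↦ (Π K(x, ·))(y)`, that is, `Π` applied to `K` in its second variable,
is for fixed `y` the element `Π K(·, y)` of `H`. -/
theorem starProjection_kernelTranslate_symm (V : Submodule ℝ H) [V.HasOrthogonalProjection]
    (x y : X) : V.starProjection (kernelTranslate H x) y
      = V.starProjection (kernelTranslate H y) x := by
  have h : ∀ (f : H) (z : X), f z = inner ℝ f (kernelTranslate H z) := fun f z => by
    simp [kernelTranslate]
  rw [h, h, V.inner_starProjection_left_eq_right, real_inner_comm]

theorem continuous_kernelTranslate [TopologicalSpace X] {K : C(X × X, ℝ)}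
    (hH : IsNativeSpace K H) : Continuous (kernelTranslate H : X → H) := by
  have hin : ∀ x y : X, inner ℝ (kernelTranslate H x) (kernelTranslate H y) = K (x, y) := by
    intro x y
    rw [← hH.kernel_eq, kernelTranslate, kernelTranslate, RKHS.kerFun_inner, RKHS.kerFun_apply]
    simp
  refine continuous_iff_continuousAt.mpr fun x => ?_
  rw [ContinuousAt, tendsto_iff_norm_sub_tendsto_zero]
  have key : ∀ z, ‖kernelTranslate H z - kernelTranslate H x‖
      = √(K (z, z) - 2 * K (z, x) + K (x, x)) := fun z => by
    rw [← hin z z, ← hin z x, ← hin x x, real_inner_self_eq_norm_sq, real_inner_self_eq_norm_sq,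
      ← norm_sub_sq_real, Real.sqrt_sq (norm_nonneg _)]
  simp only [key]
  have hc : Continuous fun z => √(K (z, z) - 2 * K (z, x) + K (x, x)) := by fun_prop
  have := hc.tendsto x
  convert this using 2
  rw [eq_comm, Real.sqrt_eq_zero'] 
  linarith

/-- The kernel `K_V(x, y) = Πˣ Πʸ K(x, y)` of the closed subspace `V`, where `Π` is the
`H`-orthogonal projector onto `V`: for fixed `y` the function `x ↦ Πʸ K(x, y)` is `Π K(·, y)`,
to which `Π` is applied again. -/
def restrictedKernel [TopologicalSpace X] {K : C(X × X, ℝ)} (hH : IsNativeSpace K H)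
    (V : ClosedSubmodule ℝ H) : C(X × X, ℝ) where
  toFun p := V.toSubmodule.starProjection
    (V.toSubmodule.starProjection (kernelTranslate H p.2)) p.1
  continuous_toFun := by
    have h : ∀ (f : H) (z : X), f z = inner ℝ f (kernelTranslate H z) := fun f z => by
      simp [kernelTranslate]
    simp only [h]
    have := continuous_kernelTranslate hH
    fun_prop

variable [TopologicalSpace X] [CompactSpace X] [FirstCountableTopology X]
  [MeasurableSpace X] [BorelSpace X] (μ : Measure X) [IsFiniteMeasure μ]

/-- The eigenvalues `λ₀ ≥ λ₁ ≥ …` of the integral operator `T_V` on `L₂(μ)` with kernel `K_V`. -/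
def restrictedEigenvalue {K : C(X × X, ℝ)} (hH : IsNativeSpace K H) (V : ClosedSubmodule ℝ H)
    (j : ℕ) : ℝ :=
  orderedEigenvalue (integralOperator μ (restrictedKernel hH V)) j

/-- `E` is the span of the first `n` elements `√λ_j φ_j` of an eigenbasis of `V`: the `φ_j` are
`L₂`-orthonormal eigenfunctions of `T_V` for the `n` largest eigenvalues `λ_0 ≥ … ≥ λ_{n-1}`
(with multiplicity). The classes `φ_j` in `L₂` are represented by the functions `u_j ∈ H`. The
eigenfunctions, hence `E`, are determined up to the choice of an orthonormal basis
in each eigenspace. -/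
def IsLeadingEigenspace {K : C(X × X, ℝ)} (hH : IsNativeSpace K H) (V : ClosedSubmodule ℝ H)
    (n : ℕ) (E : Submodule ℝ H) : Prop :=
  ∃ (φ : Fin n → Lp ℝ 2 μ) (u : Fin n → H),
    Orthonormal ℝ φ ∧
    (∀ j : Fin n, integralOperator μ (restrictedKernel hH V) (φ j)
      = restrictedEigenvalue μ hH V j • φ j) ∧
    (∀ j, (φ j : X → ℝ) =ᵐ[μ] (u j : X → ℝ)) ∧
    E = Submodule.span ℝ (Set.range fun j : Fin n => √(restrictedEigenvalue μ hH V j) • u j)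

end NativeSpace

end

/-! Let `A` be the embedding of the native space into `L₂` and `A_V` its restriction to `V`. By the
reproducing property the integral operators are `A A†` and `A_V A_V†`, so `λ_j` and `λ_{j,V}` are
squared singular values. Full support makes `A` injective. Hence `A_V† A_V` has only positive
eigenvalues, and `V` has an orthonormal basis of eigenvectors, ordered as `SingularSystem`.

Write `k_x` for the kernel translate. Since `P_U(x) = ‖k_x - Π_U k_x‖`, Pythagoras gives `‖P_U‖² = ∫
‖k_x‖² - ∫ ‖Π_U k_x‖²`. By Parseval the first integral is the trace `∑ λ_j`, and the second is `∑ ‖A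
u_i‖²` for an orthonormal basis `u_i` of a finite-dimensional `U`. For `U = V` it is the trace `∑
λ_{j,V}`.

Minimizing `‖P_U‖` over `n`-dimensional `U ⊆ V` thus means maximizing `∑ ‖A u_i‖²`, which is Ky
Fan's principle. `hasSum_kyFan` writes the defect as a sum of nonnegative terms. If it vanishes,
every term does, so `U` is invariant under `A_V† A_V`. Its eigenvalues on `U` are bounded one by one
by the leading ones and have the same sum, so they agree. Finally `isLeadingEigenspace_iff`
translates eigenvectors in `V` into eigenfunctions in `L₂`. -/

noncomputable section

/-! ### Hilbert-Schmidt operators and decreasing enumerations. -/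

section SingularSystem

variable {E L : Type*} [NormedAddCommGroup E] [InnerProductSpace ℝ E]
  [NormedAddCommGroup L] [InnerProductSpace ℝ L]

/-- An operator whose square sums over finite orthonormal sets are bounded by `M` (a
Hilbert-Schmidt operator of squared norm at most `M`). -/
def HilbertSchmidtBound (A : E →L[ℝ] L) (M : ℝ) : Prop :=
  ∀ s : Finset E, Orthonormal ℝ ((↑) : ↥s → E) → ∑ x ∈ s, ‖A x‖ ^ 2 ≤ M

theorem orthonormal_insert_of_mem_orthogonal [DecidableEq E] {s : Finset E}
    (hs : Orthonormal ℝ ((↑) : ↥s → E)) {e : E} (he : ‖e‖ = 1)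
    (h : e ∈ (Submodule.span ℝ (s : Set E))ᗮ) :
    Orthonormal ℝ ((↑) : ↥(insert e s : Finset E) → E) := by
  have hs1 : ∀ x ∈ s, ‖x‖ = 1 := fun x hx => hs.1 ⟨x, hx⟩
  have hs2 : ∀ x ∈ s, ∀ y ∈ s, x ≠ y → inner ℝ x y = 0 := fun x hx y hy hxy =>
    hs.2 (i := ⟨x, hx⟩) (j := ⟨y, hy⟩) (by simpa using hxy)
  have hes : ∀ x ∈ s, inner ℝ x e = 0 := fun x hx =>
    (Submodule.mem_orthogonal _ _).1 h x (Submodule.subset_span hx)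
  constructor
  · rintro ⟨x, hx⟩
    rcases Finset.mem_insert.1 hx with rfl | hx
    · exact he
    · exact hs1 x hx
  · rintro ⟨x, hx⟩ ⟨y, hy⟩ hxy
    have hxy : x ≠ y := by simpa using hxy
    rcases Finset.mem_insert.1 hx with rfl | hx' <;>
      rcases Finset.mem_insert.1 hy with rfl | hy'
    · exact absurd rfl hxy
    · change inner ℝ x y = 0
      rw [real_inner_comm]
      exact hes y hy'
    · exact hes x hx'
    · exact hs2 x hx' y hy' hxy

/-- Take a finite orthonormal set whose sum is within `(ε / 2) ^ 2` of the supremum. A further unit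
vector `e` orthogonal to it can add no more, so `‖A e‖ ≤ ε / 2`. Thus `A` is a norm limit of
finite-rank operators. -/
theorem HilbertSchmidtBound.isCompactOperator [CompleteSpace L] {A : E →L[ℝ] L} {M : ℝ}
    (hA : HilbertSchmidtBound A M) : IsCompactOperator A := by
  classical
  let sums : Set ℝ :=
    {r | ∃ s : Finset E, Orthonormal ℝ ((↑) : ↥s → E) ∧ r = ∑ x ∈ s, ‖A x‖ ^ 2}
  have hne : sums.Nonempty :=
    ⟨_, ∅, ⟨fun x => absurd x.2 (Finset.notMem_empty _), fun x =>
      absurd x.2 (Finset.notMem_empty _)⟩, rfl⟩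
  have hbdd : BddAbove sums := ⟨M, by rintro _ ⟨s, hs, rfl⟩; exact hA s hs⟩
  have hmem : A ∈ closure {f : E →L[ℝ] L | IsCompactOperator f} := by
    rw [Metric.mem_closure_iff]
    intro ε hε
    obtain ⟨_, ⟨s, hs, rfl⟩, hlt⟩ := exists_lt_of_lt_csSup hne
      (sub_lt_self (sSup sums) (by positivity : 0 < (ε / 2) ^ 2))
    let W : Submodule ℝ E := Submodule.span ℝ (s : Set E)
    have : FiniteDimensional ℝ W := FiniteDimensional.span_finset ℝ s
    refine ⟨A ∘L W.starProjection, ?_, ?_⟩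
    · have : IsCompactOperator (W.subtypeL ∘L W.orthogonalProjectionOnto : E →L[ℝ] E) := by
        refine (isCompactOperator_of_locallyCompactSpace_rng W.subtypeL).comp_clm W.orthogonalProjectionOnto
      exact this.clm_comp A
    · rw [dist_eq_norm]
      refine lt_of_le_of_lt (ContinuousLinearMap.opNorm_le_bound _ (half_pos hε).le fun x => ?_)
        (half_lt_self hε)
      let y := x - W.starProjection x
      have hy : y ∈ Wᗮ := W.sub_starProjection_mem_orthogonal x
      have hyx : ‖y‖ ≤ ‖x‖ := by
        have h : y = Wᗮ.starProjection x := by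
          rw [Submodule.starProjection_orthogonal']
          rfl
        exact h ▸ Wᗮ.norm_starProjection_apply_le x
      have hAy : ‖A y‖ ≤ ε / 2 * ‖y‖ := by
        rcases eq_or_ne y 0 with h0 | h0
        · simp [h0]
        · have hn : ‖y‖ ≠ 0 := norm_ne_zero_iff.2 h0
          let e := ‖y‖⁻¹ • y
          have he : ‖e‖ = 1 := by simp [e, norm_smul, hn]
          have heW : e ∈ Wᗮ := Wᗮ.smul_mem _ hy
          have hes : e ∉ s := fun h => by
            have := (Submodule.mem_orthogonal _ _).1 heW e (Submodule.subset_span h)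
            rw [real_inner_self_eq_norm_sq, he] at this
            norm_num at this
          have hle := le_csSup hbdd ⟨_, orthonormal_insert_of_mem_orthogonal hs he heW, rfl⟩
          rw [Finset.sum_insert hes] at hle
          have hlt' : ‖A e‖ ≤ ε / 2 := by
            refine abs_le_of_sq_le_sq' (by linarith) (half_pos hε).le |>.2
          have : y = ‖y‖ • e := by simp [e, smul_smul, hn]
          rw [this, map_smul, norm_smul, norm_smul, he]
          simp only [norm_norm, mul_one]
          nlinarith [norm_nonneg y]
      calc ‖(A - A ∘L W.starProjection) x‖ = ‖A y‖ := by simp [y]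
        _ ≤ ε / 2 * ‖y‖ := hAy
        _ ≤ ε / 2 * ‖x‖ := by gcongr
  rwa [(isClosed_setOfPred_isCompactOperator (σ₁₂ := RingHom.id ℝ)).closure_eq] at hmem

/-- A real family with finite superlevel sets can be enumerated in decreasing order by an initial
segment of `ℕ`. -/
theorem exists_antitone_enumeration {ι : Type*} (σ : ι → ℝ)
    (hfin : ∀ i, {k | σ i ≤ σ k}.Finite) :
    ∃ (s : Set ℕ) (e : s ≃ ι), IsLowerSet s ∧ ∀ i j : s, i ≤ j → σ (e j) ≤ σ (e i) := by
  -- Ties are broken by an arbitrary well-order. This gives a strict total order in which each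
  -- element has finitely many predecessors; their number is its position.
  let before : ι → ι → Prop := fun k i => σ i < σ k ∨ (σ i = σ k ∧ WellOrderingRel k i)
  have htrans : ∀ {a b c}, before a b → before b c → before a c := by
    rintro a b c (h | ⟨h, h'⟩) (g | ⟨g, g'⟩)
    · exact Or.inl (g.trans h)
    · exact Or.inl (g ▸ h)
    · exact Or.inl (h ▸ g)
    · exact Or.inr ⟨g.trans h, _root_.trans h' g'⟩
  have hirr : ∀ a, ¬ before a a := by
    rintro a (h | ⟨-, h⟩)
    · exact lt_irrefl _ h
    · exact irrefl _ h
  have htri : ∀ a b, a ≠ b → before a b ∨ before b a := by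
    intro a b hab
    rcases lt_trichotomy (σ a) (σ b) with h | h | h
    · exact Or.inr (Or.inl h)
    · rcases trichotomous_of WellOrderingRel a b with g | g | g
      · exact Or.inl (Or.inr ⟨h.symm, g⟩)
      · exact absurd g hab
      · exact Or.inr (Or.inr ⟨h, g⟩)
    · exact Or.inl (Or.inl h)
  have hpfin : ∀ i, {k | before k i}.Finite := fun i => (hfin i).subset fun k hk => by
    rcases hk with h | ⟨h, -⟩
    · exact h.le
    · exact h.le
  let rk : ι → ℕ := fun i => {k | before k i}.ncard
  have hlt : ∀ {a b}, before a b → rk a < rk b := fun {a b} hab =>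
    Set.ncard_lt_ncard ⟨fun k hk => htrans hk hab, fun h => hirr a (h hab)⟩ (hpfin b)
  have hinj : Function.Injective rk := fun a b hab => by
    by_contra hne
    rcases htri a b hne with h | h
    · exact (hlt h).ne hab
    · exact (hlt h).ne' hab
  -- An injective image of `rk i` predecessors inside `Set.Iio (rk i)` fills it, so positions have
  -- no gaps.
  have hlow : ∀ i, rk '' {k | before k i} = Set.Iio (rk i) := fun i => by
    refine Set.eq_of_subset_of_ncard_le ?_ ?_ (Set.finite_Iio _)
    · rintro _ ⟨k, hk, rfl⟩
      exact hlt hk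
    · rw [Set.ncard_image_of_injective _ hinj]
      simp [rk, Set.ncard_eq_toFinset_card']
  refine ⟨Set.range rk, (Equiv.ofInjective rk hinj).symm, ?_, ?_⟩
  · rintro _ m hm ⟨i, rfl⟩
    rcases hm.eq_or_lt with rfl | hm
    · exact ⟨i, rfl⟩
    · obtain ⟨k, -, hk⟩ := (hlow i).symm.subset hm
      exact ⟨k, hk⟩
  · rintro ⟨_, a, rfl⟩ ⟨_, b, rfl⟩ hab
    have h : ∀ c, (Equiv.ofInjective rk hinj).symm ⟨rk c, c, rfl⟩ = c :=
      fun c => Equiv.ofInjective_symm_apply hinj c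
    rw [h, h]
    by_contra hcon
    exact absurd (hlt (Or.inl (not_le.1 hcon) : before b a)) (not_lt.2 hab)

end SingularSystem

/-! ### Existence of singular systems. -/

section SingularSystem

variable {E L : Type*} [NormedAddCommGroup E] [InnerProductSpace ℝ E]
  [NormedAddCommGroup L] [InnerProductSpace ℝ L]

theorem HilbertSchmidtBound.sum_le {A : E →L[ℝ] L} {M : ℝ} (hA : HilbertSchmidtBound A M)
    {ι : Type*} {v : ι → E} (hv : Orthonormal ℝ v) (s : Finset ι) :
    ∑ i ∈ s, ‖A (v i)‖ ^ 2 ≤ M := by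
  classical
  have hinj : Function.Injective v := hv.linearIndependent.injective
  have h : Orthonormal ℝ ((↑) : ↥(s.image v) → E) := by
    have hsub : ∀ x : ↥(s.image v), (x : E) ∈ Set.range v := fun x => by
      obtain ⟨i, -, hi⟩ := Finset.mem_image.1 x.2
      exact ⟨i, hi⟩
    refine hv.toSubtypeRange.comp (fun x : ↥(s.image v) => ⟨x, hsub x⟩) fun x y hxy => ?_
    have h : (x : E) = y := congrArg (fun z : Set.range v => (z : E)) hxy
    exact Subtype.ext h
  simpa [Finset.sum_image hinj.injOn] using hA _ h

/-- The initial segment of `ℕ` of cardinality `dim E` (all of `ℕ` in infinite dimension). -/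
abbrev RankIndex (E : Type*) [AddCommGroup E] [Module ℝ E] : Type :=
  {j : ℕ // (j : Cardinal) < Module.rank ℝ E}

theorem rankIndex_of_le {E : Type*} [AddCommGroup E] [Module ℝ E] {m n : ℕ} (h : m ≤ n)
    (hn : (n : Cardinal) < Module.rank ℝ E) : (m : Cardinal) < Module.rank ℝ E :=
  lt_of_le_of_lt (by exact_mod_cast h) hn

/-- A complete orthonormal system of right singular vectors of an operator `A`, ordered by
decreasing values `val j = ‖A (basis j)‖ ^ 2 > 0`; the values are continued by `0`. -/
structure SingularSystem [CompleteSpace E] [CompleteSpace L] (A : E →L[ℝ] L) where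
  /-- the right singular vectors -/
  basis : HilbertBasis (RankIndex E) ℝ E
  /-- the squares of the singular values -/
  val : ℕ → ℝ
  antitone : Antitone val
  pos : ∀ j : RankIndex E, 0 < val j
  eq_zero : ∀ j : ℕ, ¬ (j : Cardinal) < Module.rank ℝ E → val j = 0
  apply_basis : ∀ j : RankIndex E, A.adjoint (A (basis j)) = val j • basis j

/-- A total orthonormal family indexed by a lower set of `ℕ` is indexed by `RankIndex E`. -/
theorem mem_iff_lt_rank_of_orthonormal [CompleteSpace E] {s : Set ℕ} (hs : IsLowerSet s) {v : s → E}
    (hv : Orthonormal ℝ v) (htot : (Submodule.span ℝ (Set.range v))ᗮ = ⊥) (j : ℕ) :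
    j ∈ s ↔ (j : Cardinal) < Module.rank ℝ E := by
  constructor
  · intro hj
    have hmem : ∀ i : Fin (j + 1), (i : ℕ) ∈ s := fun i => hs (Nat.lt_succ_iff.1 i.2) hj
    have hli : LinearIndependent ℝ fun i : Fin (j + 1) => v ⟨i, hmem i⟩ :=
      hv.linearIndependent.comp (fun i : Fin (j + 1) => (⟨i, hmem i⟩ : s)) fun a b hab => by
        simpa [Fin.ext_iff] using hab
    have := hli.cardinal_lift_le_rank
    simp only [Cardinal.mk_fin, Cardinal.lift_natCast, Cardinal.lift_uzero] at this
    refine lt_of_lt_of_le ?_ this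
    exact_mod_cast Nat.lt_succ_self j
  · intro hj
    by_contra hjs
    have hlt : ∀ i ∈ s, i < j := fun i hi => by
      by_contra h
      exact hjs (hs (not_lt.1 h) hi)
    classical
    -- Padding by zeros exhibits the whole family among `j` vectors; being total, it would force
    -- `dim E ≤ j`.
    let g : Fin j → E := fun i => if h : (i : ℕ) ∈ s then v ⟨i, h⟩ else 0
    have hsub : Set.range v ⊆ Set.range g := by
      rintro _ ⟨i, rfl⟩
      exact ⟨⟨i, hlt i i.2⟩, by simp [g]⟩
    have hfd : FiniteDimensional ℝ (Submodule.span ℝ (Set.range g)) :=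
      FiniteDimensional.span_of_finite ℝ (Set.finite_range g)
    have htop : Submodule.span ℝ (Set.range g) = ⊤ := by
      rw [← Submodule.orthogonal_eq_bot_iff, eq_bot_iff, ← htot]
      exact Submodule.orthogonal_le (Submodule.span_mono hsub)
    have hle : Set.finrank ℝ (Set.range g) ≤ j := by
      simpa using finrank_range_le_card (R := ℝ) g
    rw [Set.finrank, htop, finrank_top] at hle
    rw [htop] at hfd
    have : FiniteDimensional ℝ E := Module.Finite.of_surjective _
      (Submodule.topEquiv (R := ℝ) (M := E)).surjective
    rw [← Module.finrank_eq_rank] at hj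
    exact absurd (Nat.cast_lt.1 hj) (not_lt.2 hle)

variable [CompleteSpace E] [CompleteSpace L]

theorem inner_adjoint_apply_self (A : E →L[ℝ] L) (x y : E) :
    inner ℝ (A.adjoint (A x)) y = inner ℝ (A x) (A y) :=
  A.adjoint_inner_left _ _

/-- The spectral theorem for the compact self-adjoint operator `A† A` supplies a total family of
eigenvectors. Injectivity excludes the eigenvalue `0`, and the Hilbert-Schmidt bound makes
superlevel sets finite, so the eigenvalues can be listed in decreasing order. -/
theorem exists_singularSystem {A : E →L[ℝ] L} {M : ℝ} (hinj : Function.Injective A)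
    (hA : HilbertSchmidtBound A M) : Nonempty (SingularSystem A) := by
  let S : E →L[ℝ] E := A.adjoint ∘L A
  have hSc : IsCompactOperator S := by
    change IsCompactOperator (A.adjoint ∘ A)
    exact hA.isCompactOperator.clm_comp A.adjoint
  have hSs : (S : E →ₗ[ℝ] E).IsSymmetric := fun x y => by
    change inner ℝ (A.adjoint (A x)) y = inner ℝ x (A.adjoint (A y))
    rw [A.adjoint_inner_left, A.adjoint_inner_right]
  let F : ℝ → Submodule ℝ E := fun t => Module.End.eigenspace (S : Module.End ℝ E) t
  have hF : ∀ t, ∀ x ∈ F t, A.adjoint (A x) = t • x := fun t x hx =>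
    Module.End.mem_eigenspace_iff.1 hx
  have hfd : ∀ t, FiniteDimensional ℝ (F t) := fun t => by
    rcases eq_or_ne t 0 with rfl | ht
    · have : F 0 = ⊥ := by
        rw [eq_bot_iff]
        intro x hx
        have h := inner_adjoint_apply_self A x x
        rw [hF 0 x hx, zero_smul, inner_zero_left, eq_comm, inner_self_eq_zero] at h
        exact hinj (h.trans (map_zero A).symm)
      rw [this]
      infer_instance
    · exact S.finite_dimensional_eigenspace hSc t ht
  let ι := Σ t : ℝ, Fin (Module.finrank ℝ (F t))
  let w : ∀ t : ℝ, Fin (Module.finrank ℝ (F t)) → F t := fun t => stdOrthonormalBasis ℝ (F t)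
  let v : ι → E := fun i => (w i.1 i.2 : E)
  have hv : Orthonormal ℝ v :=
    hSs.orthogonalFamily_eigenspaces.orthonormal_sigma_orthonormal (v_family := w)
      fun t => (stdOrthonormalBasis ℝ (F t)).orthonormal
  have hSv : ∀ i, A.adjoint (A (v i)) = i.1 • v i := fun i => hF i.1 _ (w i.1 i.2).2
  have htot : (Submodule.span ℝ (Set.range v))ᗮ = ⊥ := by
    rw [eq_bot_iff, ← S.orthogonalComplement_iSup_eigenspaces_eq_bot hSc hSs]
    refine Submodule.orthogonal_le (iSup_le fun t x hx => ?_)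
    have h := (stdOrthonormalBasis ℝ (F t)).sum_repr ⟨x, hx⟩
    have h' := congrArg (Submodule.subtype (F t)) h
    rw [map_sum] at h'
    change _ = x at h'
    rw [← h']
    refine Submodule.sum_mem _ fun i _ => ?_
    rw [map_smul]
    exact Submodule.smul_mem _ _ (Submodule.subset_span ⟨⟨t, i⟩, rfl⟩)
  have hnorm : ∀ i, ‖A (v i)‖ ^ 2 = i.1 := fun i => by
    rw [← real_inner_self_eq_norm_sq, ← inner_adjoint_apply_self, hSv, real_inner_smul_left,
      real_inner_self_eq_norm_sq, hv.1 i]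
    norm_num
  have hpos : ∀ i : ι, 0 < i.1 := fun i => by
    rw [← hnorm]
    have : A (v i) ≠ 0 := fun h => by
      have h0 := hinj (h.trans (map_zero A).symm)
      have h1 := hv.1 i
      rw [h0, norm_zero] at h1
      norm_num at h1
    positivity
  -- `n` eigenvectors with eigenvalue at least `i.1` give `n * i.1 ≤ M`.
  have hfin : ∀ i : ι, {k : ι | i.1 ≤ k.1}.Finite := fun i => by
    by_contra hinf
    obtain ⟨n, hn⟩ := exists_nat_gt (M / i.1)
    obtain ⟨s, hs, hcard⟩ := Set.Infinite.exists_subset_card_eq hinf n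
    have h1 := hA.sum_le hv s
    have h2 : ∑ _k ∈ s, i.1 ≤ ∑ k ∈ s, ‖A (v k)‖ ^ 2 :=
      Finset.sum_le_sum fun k hk => (hnorm k).symm ▸ hs hk
    rw [Finset.sum_const, hcard, nsmul_eq_mul] at h2
    rw [div_lt_iff₀ (hpos i)] at hn
    linarith
  obtain ⟨s, e, hs, he⟩ := exists_antitone_enumeration (fun i : ι => i.1) hfin
  have hve : Orthonormal ℝ (v ∘ e) := hv.comp e e.injective
  have hrange : Set.range (v ∘ e) = Set.range v := e.surjective.range_comp v
  have hmem := mem_iff_lt_rank_of_orthonormal hs hve (hrange ▸ htot)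
  let f : RankIndex E ≃ s := Equiv.subtypeEquivRight fun j => (hmem j).symm
  have hvf : Orthonormal ℝ (v ∘ e ∘ f) := hve.comp f f.injective
  have hrange' : Set.range (v ∘ e ∘ f) = Set.range v := by
    rw [← hrange]
    exact f.surjective.range_comp (v ∘ e)
  classical
  let val : ℕ → ℝ := fun j => if h : j ∈ s then (e ⟨j, h⟩).1 else 0
  have hval : ∀ j : RankIndex E, val j = (e (f j)).1 := fun j => dif_pos (f j).2
  exact ⟨{
    basis := HilbertBasis.mkOfOrthogonalEqBot hvf (hrange'.symm ▸ htot)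
    val := val
    antitone := fun i j hij => by
      by_cases hj : j ∈ s
      · have hi : i ∈ s := hs hij hj
        simp only [val, dif_pos hi, dif_pos hj]
        exact he ⟨i, hi⟩ ⟨j, hj⟩ hij
      · simp only [val, dif_neg hj]
        split_ifs
        · exact (hpos _).le
        · exact le_rfl
    pos := fun j => hval j ▸ hpos _
    eq_zero := fun j hj => dif_neg fun h => hj ((hmem j).1 h)
    apply_basis := fun j => by
      rw [HilbertBasis.coe_mkOfOrthogonalEqBot, hval]
      exact hSv _ }⟩

end SingularSystem

theorem natCast_le_rank_of_linearIndependent {M : Type*} [AddCommGroup M] [Module ℝ M] {m : ℕ}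
    {W : Submodule ℝ M} {v : Fin m → M} (hv : LinearIndependent ℝ v) (h : ∀ i, v i ∈ W) :
    (m : Cardinal) ≤ Module.rank ℝ W := by
  have hli : LinearIndependent ℝ fun i => (⟨v i, h i⟩ : W) :=
    LinearIndependent.of_comp W.subtype hv
  have := hli.cardinal_lift_le_rank
  simpa only [Cardinal.mk_fin, Cardinal.lift_natCast, Cardinal.lift_uzero] using this

/-! ### Singular values as ordered eigenvalues of `A A†`. -/

section SingularSystem

variable {E L : Type*} [NormedAddCommGroup E] [InnerProductSpace ℝ E]
  [NormedAddCommGroup L] [InnerProductSpace ℝ L]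

theorem Submodule.mem_of_hasSum {W : Submodule ℝ E} (hW : IsClosed (W : Set E)) {ι : Type*}
    {f : ι → E} {x : E} (hf : ∀ i, f i ∈ W) (h : HasSum f x) : x ∈ W :=
  hW.mem_of_tendsto h (Filter.Eventually.of_forall fun _ => W.sum_mem fun i _ => hf i)

theorem starProjection_eq_sum_of_orthonormal {n : ℕ} {u : Fin n → E} (hu : Orthonormal ℝ u)
    {W : Submodule ℝ E} [W.HasOrthogonalProjection] (hW : Submodule.span ℝ (Set.range u) = W)
    (x : E) : W.starProjection x = ∑ i, inner ℝ (u i) x • u i := by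
  refine Submodule.eq_starProjection_of_mem_of_inner_eq_zero (K := W) ?_ ?_
  · rw [← hW]
    exact Submodule.sum_mem _ fun i _ =>
      Submodule.smul_mem _ _ (Submodule.subset_span ⟨i, rfl⟩)
  · intro y hy
    rw [← hW] at hy
    induction hy using Submodule.span_induction with
    | mem y hy =>
      obtain ⟨k, rfl⟩ := hy
      rw [inner_sub_left, real_inner_comm, sub_eq_zero, real_inner_comm (u k) (∑ i, _)]
      exact (hu.inner_right_fintype (fun i => inner ℝ (u i) x) k).symm
    | zero => exact inner_zero_right _
    | add y z _ _ hy hz => rw [inner_add_right, hy, hz, add_zero]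
    | smul a y _ hy => rw [inner_smul_right, hy, mul_zero]

theorem norm_sq_starProjection_eq_sum {n : ℕ} {u : Fin n → E} (hu : Orthonormal ℝ u)
    {W : Submodule ℝ E} [W.HasOrthogonalProjection] (hW : Submodule.span ℝ (Set.range u) = W)
    (x : E) : ‖W.starProjection x‖ ^ 2 = ∑ i, inner ℝ (u i) x ^ 2 := by
  have h : inner ℝ (W.starProjection x) (W.starProjection x) = inner ℝ (W.starProjection x) x := by
    rw [W.inner_starProjection_left_eq_right,
      Submodule.starProjection_eq_self_iff.2 (W.starProjection_apply_mem x),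
      ← W.inner_starProjection_left_eq_right]
  rw [← real_inner_self_eq_norm_sq, h, starProjection_eq_sum_of_orthonormal hu hW, sum_inner]
  exact Finset.sum_congr rfl fun i _ => by rw [real_inner_smul_left, sq]

namespace SingularSystem

variable [CompleteSpace E] [CompleteSpace L] {A : E →L[ℝ] L} (B : SingularSystem A)
include B

theorem val_nonneg (j : ℕ) : 0 ≤ B.val j := by
  by_cases h : (j : Cardinal) < Module.rank ℝ E
  · exact (B.pos ⟨j, h⟩).le
  · exact (B.eq_zero j h).ge

theorem lt_rank_of_pos {j : ℕ} (h : 0 < B.val j) : (j : Cardinal) < Module.rank ℝ E := by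
  by_contra hj
  exact h.ne' (B.eq_zero j hj)

theorem inner_basis_adjoint_apply (j : RankIndex E) (x : E) :
    inner ℝ (B.basis j) (A.adjoint (A x)) = B.val j * inner ℝ (B.basis j) x := by
  rw [A.adjoint_inner_right, ← inner_adjoint_apply_self, B.apply_basis, real_inner_smul_left]

theorem inner_apply_basis (i : RankIndex E) (x : E) :
    inner ℝ (A (B.basis i)) (A x) = B.val i * inner ℝ (B.basis i) x := by
  rw [← inner_adjoint_apply_self, B.apply_basis, real_inner_smul_left]

theorem norm_sq_apply_basis (i : RankIndex E) : ‖A (B.basis i)‖ ^ 2 = B.val i := by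
  rw [← real_inner_self_eq_norm_sq, inner_apply_basis, real_inner_self_eq_norm_sq,
    B.basis.orthonormal.1]
  norm_num

theorem injective : Function.Injective A := by
  rw [injective_iff_map_eq_zero]
  intro x hx
  refine B.basis.repr.injective ?_
  ext j
  have h := B.inner_apply_basis j x
  rw [hx, inner_zero_right, eq_comm, mul_eq_zero] at h
  simpa [HilbertBasis.repr_apply_apply] using h.resolve_left (B.pos j).ne'

theorem hasSum_norm_sq (x : E) :
    HasSum (fun j : RankIndex E => B.val j * inner ℝ (B.basis j) x ^ 2) (‖A x‖ ^ 2) := by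
  have h := B.basis.hasSum_inner_mul_inner x (A.adjoint (A x))
  rw [A.adjoint_inner_right, real_inner_self_eq_norm_sq] at h
  convert! h using 2 with j
  rw [B.inner_basis_adjoint_apply, real_inner_comm x]
  ring

theorem summable_val (hA : ∃ M, HilbertSchmidtBound A M) : Summable B.val := by
  obtain ⟨M, hA⟩ := hA
  classical
  refine summable_of_sum_le (c := M) B.val_nonneg fun s => ?_
  have h := hA.sum_le B.basis.orthonormal
    (s.subtype fun j : ℕ => (j : Cardinal) < Module.rank ℝ E)
  simp_rw [B.norm_sq_apply_basis] at h
  rw [Finset.sum_subtype_eq_sum_filter] at h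
  rwa [Finset.sum_filter_of_ne fun j _ hj => ?_] at h
  exact B.lt_rank_of_pos ((B.val_nonneg j).lt_of_ne' hj)

/-- The span of the first `n` singular vectors. -/
def lead (n : ℕ) : Submodule ℝ E :=
  Submodule.span ℝ (Set.range fun i : Fin n =>
    if h : ((i : ℕ) : Cardinal) < Module.rank ℝ E then B.basis ⟨i, h⟩ else 0)

instance (n : ℕ) : FiniteDimensional ℝ (B.lead n) :=
  FiniteDimensional.span_of_finite ℝ (Set.finite_range _)

theorem finrank_lead_le (n : ℕ) : Module.finrank ℝ (B.lead n) ≤ n := by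
  simpa using! finrank_range_le_card (R := ℝ) (ι := Fin n) _

theorem mem_lead_of_inner_eq_zero {n : ℕ} {x : E}
    (h : ∀ j : RankIndex E, n ≤ j → inner ℝ (B.basis j) x = 0) : x ∈ B.lead n := by
  refine Submodule.mem_of_hasSum (B.lead n).closed_of_finiteDimensional (fun j => ?_)
    (B.basis.hasSum_repr x)
  rw [B.basis.repr_apply_apply]
  rcases le_or_gt n j with hj | hj
  · rw [h j hj, zero_smul]
    exact Submodule.zero_mem _
  · refine Submodule.smul_mem _ _ (Submodule.subset_span ⟨⟨j, hj⟩, ?_⟩)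
    simp only [dif_pos j.2]

/-- Eigenvectors for different eigenvalues are orthogonal, and `s` exceeds all values from index `n`
on. -/
theorem mem_lead_of_eigenvector {n : ℕ} {x : E} {s : ℝ} (hx : A.adjoint (A x) = s • x)
    (hs : B.val n < s) : x ∈ B.lead n := by
  refine B.mem_lead_of_inner_eq_zero fun j hj => ?_
  have h := B.inner_basis_adjoint_apply j x
  rw [hx, real_inner_smul_right] at h
  have : B.val j < s := (B.antitone hj).trans_lt hs
  have h0 : (s - B.val j) * inner ℝ (B.basis j) x = 0 := by linarith
  exact (mul_eq_zero.1 h0).resolve_left (sub_pos.2 this).ne'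

/-- `A†` and `A` exchange eigenvectors of `A A†` and `A† A` for a nonzero eigenvalue. If `B.val j <
t`, the eigenspaces lie in the image of `lead j`, of dimension at most `j`. Otherwise the images of
the first `j + 1` basis vectors are independent in their span. -/
theorem lt_rank_iSup_eigenspace_iff {T : L →ₗ[ℝ] L} (hT : ∀ f, T f = A (A.adjoint f)) {t : ℝ}
    (ht : 0 < t) (j : ℕ) :
    (j : Cardinal) < Module.rank ℝ ↥(⨆ (s : ℝ) (_ : t ≤ s), Module.End.eigenspace T s) ↔
      t ≤ B.val j := by
  constructor
  · intro h
    by_contra hlt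
    have hle : (⨆ (s : ℝ) (_ : t ≤ s), Module.End.eigenspace T s)
        ≤ (B.lead j).map (A : E →ₗ[ℝ] L) := by
      refine iSup₂_le fun s hs f hf => ?_
      have hf : A (A.adjoint f) = s • f := (hT f).symm.trans (Module.End.mem_eigenspace_iff.1 hf)
      have hs0 : s ≠ 0 := (ht.trans_le hs).ne'
      have hg : A.adjoint f ∈ B.lead j := by
        refine B.mem_lead_of_eigenvector (s := s) ?_ ((not_le.1 hlt).trans_le hs)
        rw [hf, map_smul]
      refine ⟨s⁻¹ • A.adjoint f, Submodule.smul_mem _ _ hg, ?_⟩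
      change A (s⁻¹ • A.adjoint f) = f
      rw [map_smul, hf, smul_smul, inv_mul_cancel₀ hs0, one_smul]
    have h1 := h.trans_le (Submodule.rank_mono hle)
    rw [← Module.finrank_eq_rank] at h1
    have h2 := Submodule.finrank_map_le (A : E →ₗ[ℝ] L) (B.lead j)
    have h3 := B.finrank_lead_le j
    have h4 := Nat.cast_lt.1 h1
    omega
  · intro h
    have hj : (j : Cardinal) < Module.rank ℝ E := B.lt_rank_of_pos (ht.trans_le h)
    have hmem : ∀ i : Fin (j + 1), ((i : ℕ) : Cardinal) < Module.rank ℝ E :=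
      fun i => rankIndex_of_le (Nat.lt_succ_iff.1 i.2) hj
    have hli : LinearIndependent ℝ fun i : Fin (j + 1) => B.basis ⟨i, hmem i⟩ :=
      B.basis.orthonormal.linearIndependent.comp
        (fun i : Fin (j + 1) => (⟨i, hmem i⟩ : RankIndex E)) fun a b hab => by
          simpa [Fin.ext_iff] using hab
    have hli' := hli.map' (A : E →ₗ[ℝ] L) (LinearMap.ker_eq_bot.2 B.injective)
    refine lt_of_lt_of_le ?_ (natCast_le_rank_of_linearIndependent hli' fun i => ?_)
    · exact_mod_cast Nat.lt_succ_self j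
    · refine Submodule.mem_iSup_of_mem (B.val i) (Submodule.mem_iSup_of_mem
        (h.trans (B.antitone (Nat.lt_succ_iff.1 i.2))) (Module.End.mem_eigenspace_iff.2 ?_))
      change T (A _) = _ • A _
      rw [hT, B.apply_basis, map_smul]

theorem orderedEigenvalue_eq {T : L →ₗ[ℝ] L} (hT : ∀ f, T f = A (A.adjoint f)) (j : ℕ) :
    orderedEigenvalue T j = B.val j := by
  have h : {t : ℝ | 0 < t ∧
      (j : Cardinal) < Module.rank ℝ ↥(⨆ (s : ℝ) (_ : t ≤ s), Module.End.eigenspace T s)}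
      = Set.Ioc 0 (B.val j) := by
    ext t
    exact and_congr_right fun ht => B.lt_rank_iSup_eigenspace_iff hT ht j
  rw [orderedEigenvalue, h]
  -- For value `0` the set is empty, and the convention `sSup ∅ = 0` gives the right answer.
  rcases (B.val_nonneg j).eq_or_lt with h0 | h0
  · rw [← h0, Set.Ioc_self, Real.sSup_empty]
  · exact csSup_Ioc h0

end SingularSystem

end SingularSystem

theorem hasSum_ite_rankIndex {E : Type*} [AddCommGroup E] [Module ℝ E] {n : ℕ}
    (hn : (n : Cardinal) ≤ Module.rank ℝ E) (a : ℕ → ℝ) :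
    HasSum (fun j : RankIndex E => if (j : ℕ) < n then a j else 0)
      (∑ j ∈ Finset.range n, a j) := by
  have h : HasSum (fun j : ℕ => if j < n then a j else 0) (∑ j ∈ Finset.range n, a j) := by
    have h1 : ∑ j ∈ Finset.range n, a j = ∑ j ∈ Finset.range n, if j < n then a j else 0 :=
      Finset.sum_congr rfl fun j hj => (if_pos (Finset.mem_range.1 hj)).symm
    rw [h1]
    exact hasSum_sum_of_ne_finset_zero fun j hj => if_neg fun h => hj (Finset.mem_range.2 h)
  refine (hasSum_subtype_iff_of_support_subset
    (s := {j : ℕ | (j : Cardinal) < Module.rank ℝ E}) fun j hj => ?_).2 h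
  have hj : j < n := by
    by_contra hlt
    exact hj (if_neg hlt)
  exact lt_of_lt_of_le (by exact_mod_cast hj) hn

/-! ### Ky Fan's maximum principle and its equality case. -/

section SingularSystem

variable {E L : Type*} [NormedAddCommGroup E] [InnerProductSpace ℝ E]
  [NormedAddCommGroup L] [InnerProductSpace ℝ L]

theorem mem_of_norm_sq_starProjection_eq {W : Submodule ℝ E}
    [W.HasOrthogonalProjection] {x : E} (h : ‖W.starProjection x‖ ^ 2 = ‖x‖ ^ 2) :
    x ∈ W :=
  (W.mem_iff_norm_starProjection x).2 ((sq_eq_sq₀ (norm_nonneg _) (norm_nonneg _)).1 h)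

theorem eigenvalue_eq_norm_sq [CompleteSpace E] [CompleteSpace L] {A : E →L[ℝ] L} {x : E} {t : ℝ}
    (hx : ‖x‖ = 1) (h : A.adjoint (A x) = t • x) :
    t = ‖A x‖ ^ 2 := by
  rw [← real_inner_self_eq_norm_sq, ← inner_adjoint_apply_self, h, real_inner_smul_left,
    real_inner_self_eq_norm_sq, hx]
  norm_num

namespace SingularSystem

variable [CompleteSpace E] [CompleteSpace L] {A : E →L[ℝ] L} (B : SingularSystem A)
  {n : ℕ} {u : Fin n → E} {W : Submodule ℝ E} [W.HasOrthogonalProjection]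
include B

/-- The trace of the projector onto `W`, computed in the basis of `B`. -/
theorem hasSum_norm_sq_starProjection_basis (hu : Orthonormal ℝ u)
    (hW : Submodule.span ℝ (Set.range u) = W) :
    HasSum (fun j => ‖W.starProjection (B.basis j)‖ ^ 2) n := by
  simp_rw [norm_sq_starProjection_eq_sum hu hW]
  have h : (n : ℝ) = ∑ i, ‖u i‖ ^ 2 := by simp [hu.1]
  rw [h]
  refine hasSum_sum fun i _ => ?_
  have := B.basis.hasSum_inner_mul_inner (u i) (u i)
  rw [real_inner_self_eq_norm_sq] at this
  convert! this using 2 with j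
  rw [real_inner_comm (u i), sq]

theorem hasSum_val_mul_norm_sq_starProjection_basis (hu : Orthonormal ℝ u)
    (hW : Submodule.span ℝ (Set.range u) = W) :
    HasSum (fun j : RankIndex E => B.val j * ‖W.starProjection (B.basis j)‖ ^ 2)
      (∑ i, ‖A (u i)‖ ^ 2) := by
  simp_rw [norm_sq_starProjection_eq_sum hu hW, Finset.mul_sum]
  refine hasSum_sum fun i _ => ?_
  convert! B.hasSum_norm_sq (u i) using 3 with j
  rw [real_inner_comm]

/-- The indicator of `j < n` and the weights `‖W.starProjection (B.basis j)‖ ^ 2` both sum to `n`,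
so subtracting the constant `B.val (n - 1)` from the values changes nothing. It makes the two
factors agree in sign; for `n = 0` the constant is `B.val 0`, and both are nonpositive. -/
theorem hasSum_kyFan (hn : (n : Cardinal) ≤ Module.rank ℝ E) (hu : Orthonormal ℝ u)
    (hW : Submodule.span ℝ (Set.range u) = W) :
    HasSum (fun j : RankIndex E => (B.val j - B.val (n - 1)) *
        ((if (j : ℕ) < n then 1 else 0) - ‖W.starProjection (B.basis j)‖ ^ 2))
      (∑ j ∈ Finset.range n, B.val j - ∑ i, ‖A (u i)‖ ^ 2) := by
  have h1 := hasSum_ite_rankIndex hn B.val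
  have h2 := hasSum_ite_rankIndex hn fun _ => B.val (n - 1)
  have h3 := B.hasSum_val_mul_norm_sq_starProjection_basis hu hW
  have h4 := (B.hasSum_norm_sq_starProjection_basis hu hW).mul_left (B.val (n - 1))
  convert! (h1.sub h3).sub (h2.sub h4) using 1
  · funext j
    split_ifs <;> ring
  · simp [mul_comm]

theorem kyFan_term_nonneg (j : RankIndex E) :
    0 ≤ (B.val j - B.val (n - 1)) *
        ((if (j : ℕ) < n then 1 else 0) - ‖W.starProjection (B.basis j)‖ ^ 2) := by
  have hle : ‖W.starProjection (B.basis j)‖ ^ 2 ≤ 1 := by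
    have := W.norm_starProjection_apply_le (B.basis j)
    rw [B.basis.orthonormal.1] at this
    exact pow_le_one₀ (norm_nonneg _) this
  split_ifs with h
  · exact mul_nonneg (sub_nonneg.2 (B.antitone (by omega))) (sub_nonneg.2 hle)
  · refine mul_nonneg_of_nonpos_of_nonpos (sub_nonpos.2 (B.antitone (by omega))) ?_
    rw [zero_sub]
    exact neg_nonpos.2 (sq_nonneg _)

/-- Ky Fan's maximum principle. -/
theorem sum_norm_sq_le (hn : (n : Cardinal) ≤ Module.rank ℝ E) (hu : Orthonormal ℝ u) :
    ∑ i, ‖A (u i)‖ ^ 2 ≤ ∑ j ∈ Finset.range n, B.val j := by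
  have : FiniteDimensional ℝ (Submodule.span ℝ (Set.range u)) :=
    FiniteDimensional.span_of_finite ℝ (Set.finite_range u)
  exact sub_nonneg.1 ((B.hasSum_kyFan hn hu rfl).nonneg fun j =>
    B.kyFan_term_nonneg j)

/-- A maximizer in Ky Fan's principle is an invariant subspace. -/
theorem adjoint_apply_mem_of_sum_eq (hn : (n : Cardinal) ≤ Module.rank ℝ E)
    (hu : Orthonormal ℝ u) (hW : Submodule.span ℝ (Set.range u) = W)
    (heq : ∑ i, ‖A (u i)‖ ^ 2 = ∑ j ∈ Finset.range n, B.val j) {x : E} (hx : x ∈ W) :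
    A.adjoint (A x) ∈ W := by
  have hfd : FiniteDimensional ℝ W := hW ▸ FiniteDimensional.span_of_finite ℝ (Set.finite_range u)
  have hsum := B.hasSum_kyFan hn hu hW
  rw [heq, sub_self, hasSum_zero_iff_of_nonneg B.kyFan_term_nonneg] at hsum
  -- These are the terms of `A† A x - B.val (n - 1) • x`. Where the coefficient is nonzero, the
  -- vanishing defect puts `B.basis j` into `W` if `j < n` and into its orthogonal complement
  -- otherwise.
  have hterm : ∀ j : RankIndex E, (B.val j - B.val (n - 1)) • inner ℝ (B.basis j) x • B.basis j
      ∈ W := by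
    intro j
    have h0 := congrFun hsum j
    simp only [Pi.zero_apply, mul_eq_zero] at h0
    rcases h0 with h0 | h0
    · rw [h0, zero_smul]
      exact W.zero_mem
    · split_ifs at h0 with hj
      · refine W.smul_mem _ (W.smul_mem _ (mem_of_norm_sq_starProjection_eq ?_))
        rw [B.basis.orthonormal.1]
        linarith
      · have hP : W.starProjection (B.basis j) = 0 := by
          rw [zero_sub, neg_eq_zero] at h0
          exact norm_eq_zero.1 (pow_eq_zero_iff (two_ne_zero) |>.1 h0)
        have : inner ℝ (B.basis j) x = 0 := by
          rw [← W.starProjection_eq_self_iff.2 hx, ← W.inner_starProjection_left_eq_right, hP,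
            inner_zero_left]
        rw [this, zero_smul, smul_zero]
        exact W.zero_mem
  have h1 := B.basis.hasSum_repr (A.adjoint (A x))
  have h2 := (B.basis.hasSum_repr x).const_smul (B.val (n - 1))
  have h3 : A.adjoint (A x) - B.val (n - 1) • x ∈ W := by
    refine Submodule.mem_of_hasSum W.closed_of_finiteDimensional hterm ?_
    convert! h1.sub h2 using 2 with j
    rw [B.basis.repr_apply_apply, B.basis.repr_apply_apply, B.inner_basis_adjoint_apply, sub_smul,
      smul_smul, smul_smul]
  simpa using W.add_mem h3 (W.smul_mem (B.val (n - 1)) hx)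

/-- Decreasingly ordered eigenvalues on an invariant subspace are bounded by those of `A† A`. -/
theorem eigenvalue_le_val (hu : Orthonormal ℝ u) {τ : Fin n → ℝ} (hτ : Antitone τ)
    (h : ∀ i, A.adjoint (A (u i)) = τ i • u i) (i : Fin n) : τ i ≤ B.val i := by
  by_contra hlt
  have hlt := not_le.1 hlt
  -- Otherwise `i + 1` independent vectors would lie in a space of dimension at most `i`.
  have hmem : ∀ k : Fin (i + 1), u (k.castLE i.2) ∈ B.lead i := fun k =>
    B.mem_lead_of_eigenvector (h _) (hlt.trans_le (hτ (Nat.lt_succ_iff.1 k.2)))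
  have hli : LinearIndependent ℝ fun k : Fin (i + 1) => u (k.castLE i.2) :=
    hu.linearIndependent.comp _ (Fin.castLE_injective _)
  have h1 := natCast_le_rank_of_linearIndependent hli hmem
  rw [← Module.finrank_eq_rank] at h1
  have h2 := Nat.cast_le.1 h1
  have h3 := B.finrank_lead_le i
  omega

/-- A maximizer in Ky Fan's principle is spanned by eigenvectors for the leading eigenvalues. -/
theorem exists_eigenvectors_of_sum_eq (hn : (n : Cardinal) ≤ Module.rank ℝ E)
    (hu : Orthonormal ℝ u) (hW : Submodule.span ℝ (Set.range u) = W)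
    (heq : ∑ i, ‖A (u i)‖ ^ 2 = ∑ j ∈ Finset.range n, B.val j) :
    ∃ v : Fin n → E, Orthonormal ℝ v ∧ Submodule.span ℝ (Set.range v) = W ∧
      ∀ i, A.adjoint (A (v i)) = B.val i • v i := by
  have hfd : FiniteDimensional ℝ W := hW ▸ FiniteDimensional.span_of_finite ℝ (Set.finite_range u)
  let S : W →ₗ[ℝ] W := ((A.adjoint ∘L A : E →L[ℝ] E) : E →ₗ[ℝ] E).restrict
    fun x hx => B.adjoint_apply_mem_of_sum_eq hn hu hW heq hx
  have hS : S.IsSymmetric := fun x y => by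
    change inner ℝ (A.adjoint (A (x : E))) (y : E) = inner ℝ (x : E) (A.adjoint (A (y : E)))
    rw [A.adjoint_inner_left, A.adjoint_inner_right]
  have hfr : Module.finrank ℝ W = n := by
    rw [← hW, finrank_span_eq_card hu.linearIndependent, Fintype.card_fin]
  let v : Fin n → E := fun i => (hS.eigenvectorBasis hfr i : E)
  have hv : Orthonormal ℝ v :=
    (hS.eigenvectorBasis hfr).orthonormal.comp_linearIsometry W.subtypeₗᵢ
  have hvW : Submodule.span ℝ (Set.range v) = W := by
    refine Submodule.eq_of_le_of_finrank_eq ?_ ?_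
    · rw [Submodule.span_le]
      rintro _ ⟨i, rfl⟩
      exact (hS.eigenvectorBasis hfr i).2
    · rw [finrank_span_eq_card hv.linearIndependent, Fintype.card_fin, hfr]
  have hSv : ∀ i, A.adjoint (A (v i)) = hS.eigenvalues hfr i • v i := fun i =>
    congrArg Subtype.val (hS.apply_eigenvectorBasis hfr i)
  have hle := B.eigenvalue_le_val hv (hS.eigenvalues_antitone hfr) hSv
  -- The sum `∑ ‖A (u i)‖ ^ 2` depends only on the span `W`, so it may be computed in the
  -- eigenbasis.
  have hsum : ∑ i, hS.eigenvalues hfr i = ∑ i : Fin n, B.val i := by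
    have h1 : ∑ i, hS.eigenvalues hfr i = ∑ i, ‖A (v i)‖ ^ 2 :=
      Finset.sum_congr rfl fun i _ => eigenvalue_eq_norm_sq (hv.1 i) (hSv i)
    rw [h1, (B.hasSum_val_mul_norm_sq_starProjection_basis hv hvW).unique
      (B.hasSum_val_mul_norm_sq_starProjection_basis hu hW), heq, Finset.sum_range]
  have hall := (Finset.sum_eq_sum_iff_of_le fun i _ => hle i).1 hsum
  exact ⟨v, hv, hvW, fun i => hall i (Finset.mem_univ i) ▸ hSv i⟩

end SingularSystem

end SingularSystem

theorem HilbertSchmidtBound.comp_subtypeL {E L : Type*} [NormedAddCommGroup E]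
    [InnerProductSpace ℝ E] [NormedAddCommGroup L] [InnerProductSpace ℝ L] {A : E →L[ℝ] L} {M : ℝ}
    (hA : HilbertSchmidtBound A M) (W : Submodule ℝ E) :
    HilbertSchmidtBound (A ∘L W.subtypeL) M := fun s hs => by
  have h := hA.sum_le (hs.comp_linearIsometry W.subtypeₗᵢ) Finset.univ
  rw [← Finset.sum_coe_sort]
  exact h

/-! ### Power function, embedding into `L₂` and integral operators. -/

section NativeSpace

variable {X : Type*} {H : Type*} [NormedAddCommGroup H] [InnerProductSpace ℝ H]
  [CompleteSpace H] [RKHS ℝ H X ℝ]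

theorem inner_kernelTranslate (f : H) (x : X) : inner ℝ f (kernelTranslate H x) = f x := by
  simp [kernelTranslate]

/-- The residual of the kernel translate is the Riesz representer of the error functional. -/
theorem powerFunction_eq_norm (U : Submodule ℝ H) [U.HasOrthogonalProjection] (x : X) :
    powerFunction U x = ‖kernelTranslate H x - U.starProjection (kernelTranslate H x)‖ := by
  set r := kernelTranslate H x - U.starProjection (kernelTranslate H x) with hr
  have h : ∀ f : H, f x - U.starProjection f x = inner ℝ f r := fun f => by
    rw [hr, inner_sub_right, ← U.inner_starProjection_left_eq_right, inner_kernelTranslate,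
      inner_kernelTranslate]
  have hle : ∀ f : {f : H // ‖f‖ ≤ 1}, |f.1 x - U.starProjection f.1 x| ≤ ‖r‖ := fun f => by
    rw [h]
    refine (abs_real_inner_le_norm _ _).trans ?_
    exact mul_le_of_le_one_left (norm_nonneg _) f.2
  have : Nonempty {f : H // ‖f‖ ≤ 1} := ⟨⟨0, by simp⟩⟩
  refine le_antisymm (ciSup_le hle) ?_
  rcases eq_or_ne r 0 with h0 | h0
  · rw [h0, norm_zero]
    exact Real.iSup_nonneg fun f => abs_nonneg _
  · have hn : ‖r‖ ≠ 0 := norm_ne_zero_iff.2 h0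
    refine le_ciSup_of_le ⟨‖r‖, by rintro _ ⟨f, rfl⟩; exact hle f⟩
      ⟨‖r‖⁻¹ • r, by simp [norm_smul, hn]⟩ ?_
    rw [h, real_inner_smul_left, real_inner_self_eq_norm_sq]
    refine le_trans (le_of_eq ?_) (le_abs_self _)
    field_simp

theorem sq_powerFunction (U : Submodule ℝ H) [U.HasOrthogonalProjection] (x : X) :
    powerFunction U x ^ 2
      = ‖kernelTranslate H x‖ ^ 2 - ‖U.starProjection (kernelTranslate H x)‖ ^ 2 := by
  rw [powerFunction_eq_norm, U.norm_sq_eq_add_norm_sq_starProjection (kernelTranslate H x),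
    U.starProjection_orthogonal_val]
  ring

variable [TopologicalSpace X] {K : C(X × X, ℝ)}

namespace IsNativeSpace

theorem continuous_powerFunction (hH : IsNativeSpace K H) (U : Submodule ℝ H)
    [U.HasOrthogonalProjection] : Continuous (powerFunction U : X → ℝ) := by
  rw [funext (powerFunction_eq_norm (X := X) U)]
  have := continuous_kernelTranslate hH
  fun_prop

theorem continuous_coe (hH : IsNativeSpace K H) (f : H) : Continuous (f : X → ℝ) := by
  have h := continuous_kernelTranslate hH
  have : (f : X → ℝ) = fun x => inner ℝ f (kernelTranslate H x) :=
    funext fun x => (inner_kernelTranslate f x).symm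
  rw [this]
  fun_prop

variable [CompactSpace X]

theorem exists_norm_kernelTranslate_le (hH : IsNativeSpace K H) :
    ∃ C : ℝ, 0 ≤ C ∧ ∀ x : X, ‖kernelTranslate H x‖ ≤ C := by
  obtain ⟨C, hC⟩ := (isCompact_range (continuous_kernelTranslate hH).norm).bddAbove
  exact ⟨max C 0, le_max_right _ _, fun x => (hC ⟨x, rfl⟩).trans (le_max_left _ _)⟩

/-- The embedding of the native space into the continuous functions. -/
def toContinuousMap (hH : IsNativeSpace K H) : H →L[ℝ] C(X, ℝ) :=
  LinearMap.mkContinuous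
    { toFun := fun f => ⟨f, hH.continuous_coe f⟩
      map_add' := fun f g => by ext x; simp
      map_smul' := fun c f => by ext x; simp }
    hH.exists_norm_kernelTranslate_le.choose fun f => by
      obtain ⟨h0, hC⟩ := hH.exists_norm_kernelTranslate_le.choose_spec
      refine (ContinuousMap.norm_le _ (mul_nonneg h0 (norm_nonneg _))).2 fun x => ?_
      change |f x| ≤ _
      rw [← inner_kernelTranslate, mul_comm]
      exact (abs_real_inner_le_norm _ _).trans (by gcongr; exact hC x)

variable [MeasurableSpace X] [BorelSpace X] (μ : Measure X) [IsFiniteMeasure μ]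

theorem memLp_of_continuous {f : X → ℝ} (hf : Continuous f) : MemLp f 2 μ :=
  MemLp.of_bound hf.aestronglyMeasurable ‖(⟨f, hf⟩ : C(X, ℝ))‖
    (Filter.Eventually.of_forall fun x => ContinuousMap.norm_coe_le_norm ⟨f, hf⟩ x)

theorem integrable_of_continuous {f : X → ℝ} (hf : Continuous f) : Integrable f μ :=
  (memLp_of_continuous μ hf).integrable (by norm_num)

theorem integrable_sq (hH : IsNativeSpace K H) (f : H) : Integrable (fun x : X => f x ^ 2) μ :=
  integrable_of_continuous μ ((hH.continuous_coe f).pow 2)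

/-- The embedding of the native space into `L₂(μ)`. -/
def toL2 (hH : IsNativeSpace K H) : H →L[ℝ] Lp ℝ 2 μ :=
  ContinuousMap.toLp 2 μ ℝ ∘L hH.toContinuousMap

theorem coeFn_toL2 (hH : IsNativeSpace K H) (f : H) : (hH.toL2 μ f : X → ℝ) =ᵐ[μ] (f : X → ℝ) :=
  ContinuousMap.coeFn_toLp μ (hH.toContinuousMap f)

theorem toL2_injective [μ.IsOpenPosMeasure] (hH : IsNativeSpace K H) :
    Function.Injective (hH.toL2 μ) := fun f g hfg => by
  have h : (f : X → ℝ) =ᵐ[μ] (g : X → ℝ) :=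
    (hH.coeFn_toL2 μ f).symm.trans (hfg ▸ hH.coeFn_toL2 μ g)
  exact DFunLike.coe_injective
    (((hH.continuous_coe f).ae_eq_iff_eq μ (hH.continuous_coe g)).1 h)

theorem inner_toL2 (hH : IsNativeSpace K H) (φ : Lp ℝ 2 μ) (f : H) :
    inner ℝ φ (hH.toL2 μ f) = ∫ x, f x * φ x ∂μ := by
  rw [L2.inner_def]
  refine integral_congr_ae ?_
  filter_upwards [hH.coeFn_toL2 μ f] with x hx
  rw [hx]
  rfl

theorem norm_sq_toL2 (hH : IsNativeSpace K H) (f : H) :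
    ‖hH.toL2 μ f‖ ^ 2 = ∫ x, f x ^ 2 ∂μ := by
  rw [← real_inner_self_eq_norm_sq, inner_toL2]
  refine integral_congr_ae ?_
  filter_upwards [hH.coeFn_toL2 μ f] with x hx
  rw [hx, sq]

/-- Bessel's inequality for the kernel translate at each `x`, integrated over `x`. -/
theorem hilbertSchmidtBound_toL2 (hH : IsNativeSpace K H) :
    HilbertSchmidtBound (hH.toL2 μ) (∫ x, ‖kernelTranslate H x‖ ^ 2 ∂μ) := fun s hs => by
  have hk := continuous_kernelTranslate hH
  simp_rw [hH.norm_sq_toL2 μ]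
  rw [← integral_finsetSum _ fun f _ => hH.integrable_sq μ f]
  refine integral_mono (integrable_finsetSum _ fun f _ => hH.integrable_sq μ f)
    (integrable_of_continuous μ (hk.norm.pow 2)) fun x => ?_
  have h := hs.sum_inner_products_le (kernelTranslate H x) (s := Finset.univ)
  simp_rw [inner_kernelTranslate, Real.norm_eq_abs, sq_abs] at h
  rwa [Finset.sum_coe_sort s fun f : H => f x ^ 2] at h

theorem hasSum_norm_sq_toL2 {ι : Type*} [Countable ι] (hH : IsNativeSpace K H) {b : ι → H}
    {g : X → ℝ} (hg : ∀ x, HasSum (fun j => b j x ^ 2) (g x))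
    (hs : Summable fun j => ‖hH.toL2 μ (b j)‖ ^ 2) :
    HasSum (fun j => ‖hH.toL2 μ (b j)‖ ^ 2) (∫ x, g x ∂μ) := by
  simp_rw [hH.norm_sq_toL2 μ] at hs ⊢
  rw [funext fun x => (hg x).tsum_eq.symm]
  refine hasSum_integral_of_summable_integral_norm
    (fun j => hH.integrable_sq μ (b j)) ?_
  simpa using hs

theorem lpNorm_powerFunction (hH : IsNativeSpace K H) (U : Submodule ℝ H)
    [U.HasOrthogonalProjection] :
    lpNorm (powerFunction U : X → ℝ) 2 μ = √(∫ x, ‖kernelTranslate H x‖ ^ 2 ∂μ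
      - ∫ x, ‖U.starProjection (kernelTranslate H x)‖ ^ 2 ∂μ) := by
  have hk := continuous_kernelTranslate hH
  rw [← integral_sub (integrable_of_continuous μ (by fun_prop))
    (integrable_of_continuous μ (by fun_prop)),
    lpNorm_eq_integral_norm_rpow_toReal (by norm_num) (by norm_num)
      (hH.continuous_powerFunction U).aestronglyMeasurable, Real.sqrt_eq_rpow]
  simp [sq_powerFunction]

theorem integral_norm_sq_starProjection_le (hH : IsNativeSpace K H) (U : Submodule ℝ H)
    [U.HasOrthogonalProjection] :
    ∫ x, ‖U.starProjection (kernelTranslate H x)‖ ^ 2 ∂μ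
      ≤ ∫ x, ‖kernelTranslate H x‖ ^ 2 ∂μ := by
  have hk := continuous_kernelTranslate hH
  refine integral_mono (integrable_of_continuous μ (by fun_prop))
    (integrable_of_continuous μ (by fun_prop)) fun x => ?_
  exact pow_le_pow_left₀ (norm_nonneg _) (U.norm_starProjection_apply_le _) 2

theorem integral_norm_sq_starProjection_eq_sum (hH : IsNativeSpace K H) {n : ℕ} {u : Fin n → H}
    (hu : Orthonormal ℝ u) {U : Submodule ℝ H} [U.HasOrthogonalProjection]
    (hU : Submodule.span ℝ (Set.range u) = U) :
    ∫ x, ‖U.starProjection (kernelTranslate H x)‖ ^ 2 ∂μ = ∑ i, ‖hH.toL2 μ (u i)‖ ^ 2 := by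
  simp_rw [norm_sq_starProjection_eq_sum hu hU, inner_kernelTranslate, hH.norm_sq_toL2 μ]
  exact integral_finsetSum _ fun i _ => hH.integrable_sq μ (u i)

variable [FirstCountableTopology X]

/-- Evaluating `A† f` at `x` pairs it with the kernel translate; moving `A†` across gives the
integral. -/
theorem integralOperator_eq (hH : IsNativeSpace K H) (f : Lp ℝ 2 μ) :
    integralOperator μ K f = hH.toL2 μ ((hH.toL2 μ).adjoint f) := by
  refine Lp.ext (((memLp_integral_kernel_mul μ K f).coeFn_toLp).trans
    (Filter.EventuallyEq.trans (Filter.Eventually.of_forall fun x => ?_)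
      (hH.coeFn_toL2 μ _).symm))
  change ∫ y, K (x, y) * f y ∂μ = _
  rw [← inner_kernelTranslate ((hH.toL2 μ).adjoint f), ContinuousLinearMap.adjoint_inner_left,
    inner_toL2]
  refine integral_congr_ae (Filter.Eventually.of_forall fun y => ?_)
  change K (x, y) * f y = kernelTranslate H x y * f y
  rw [← hH.kernel_eq, ← inner_kernelTranslate, real_inner_comm, inner_kernelTranslate,
    kernelTranslate, RKHS.kerFun_apply]

theorem integralOperator_restrictedKernel_eq (hH : IsNativeSpace K H) (V : ClosedSubmodule ℝ H)
    [CompleteSpace V.toSubmodule] (f : Lp ℝ 2 μ) :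
    integralOperator μ (restrictedKernel hH V) f
      = (hH.toL2 μ ∘L V.toSubmodule.subtypeL)
        ((hH.toL2 μ ∘L V.toSubmodule.subtypeL).adjoint f) := by
  refine Lp.ext (((memLp_integral_kernel_mul μ (restrictedKernel hH V) f).coeFn_toLp).trans
    (Filter.EventuallyEq.trans (Filter.Eventually.of_forall fun x => ?_)
      (hH.coeFn_toL2 μ _).symm))
  set A := hH.toL2 μ ∘L V.toSubmodule.subtypeL
  -- `p` represents evaluation at `x` on `V`, that is, it is the kernel translate of `V`.
  let p : V.toSubmodule := ⟨V.toSubmodule.starProjection (kernelTranslate H x),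
    V.toSubmodule.starProjection_apply_mem _⟩
  change ∫ y, restrictedKernel hH V (x, y) * f y ∂μ = (A.adjoint f : H) x
  have h : (A.adjoint f : H) x = inner ℝ (A.adjoint f) p := by
    change _ = inner ℝ (A.adjoint f : H) (V.toSubmodule.starProjection (kernelTranslate H x))
    rw [← V.toSubmodule.inner_starProjection_left_eq_right,
      V.toSubmodule.starProjection_eq_self_iff.2 (A.adjoint f).2, inner_kernelTranslate]
  rw [h, A.adjoint_inner_left]
  refine Eq.trans ?_ (hH.inner_toL2 μ f p).symm
  refine integral_congr_ae (Filter.Eventually.of_forall fun y => ?_)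
  change V.toSubmodule.starProjection (V.toSubmodule.starProjection (kernelTranslate H y)) x * f y
    = V.toSubmodule.starProjection (kernelTranslate H x) y * f y
  rw [V.toSubmodule.starProjection_eq_self_iff.2 (V.toSubmodule.starProjection_apply_mem _),
    starProjection_kernelTranslate_symm]

end IsNativeSpace

end NativeSpace

namespace SingularSystem

variable {E L : Type*} [NormedAddCommGroup E] [InnerProductSpace ℝ E]
  [NormedAddCommGroup L] [InnerProductSpace ℝ L] [CompleteSpace E] [CompleteSpace L]
  {A : E →L[ℝ] L} (B : SingularSystem A)
include B

theorem tsum_rankIndex : ∑' j : RankIndex E, B.val j = ∑' j, B.val j :=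
  tsum_subtype_eq_of_support_subset (s := {j : ℕ | (j : Cardinal) < Module.rank ℝ E})
    fun j hj => B.lt_rank_of_pos ((B.val_nonneg j).lt_of_ne' hj)

theorem sum_norm_sq_of_eigenvectors {n : ℕ} {v : Fin n → E} (hv : Orthonormal ℝ v)
    (h : ∀ i, A.adjoint (A (v i)) = B.val i • v i) :
    ∑ i, ‖A (v i)‖ ^ 2 = ∑ j ∈ Finset.range n, B.val j := by
  rw [Finset.sum_range]
  exact Finset.sum_congr rfl fun i _ => (eigenvalue_eq_norm_sq (hv.1 i) (h i)).symm

/-- Without a tie between the `n`-th and the next value, the leading eigenvectors span `lead n`. -/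
theorem span_eq_lead {n : ℕ} {v : Fin n → E} (hv : Orthonormal ℝ v)
    (h : ∀ i, A.adjoint (A (v i)) = B.val i • v i) (hn : ∀ i : Fin n, B.val n < B.val i) :
    Submodule.span ℝ (Set.range v) = B.lead n := by
  refine Submodule.eq_of_le_of_finrank_le ?_ ?_
  · rw [Submodule.span_le]
    rintro _ ⟨i, rfl⟩
    exact B.mem_lead_of_eigenvector (h i) (hn i)
  · rw [finrank_span_eq_card hv.linearIndependent, Fintype.card_fin]
    exact B.finrank_lead_le n

end SingularSystem

/-! ### Trace formulas, and eigenfunctions versus singular vectors. -/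

section NativeSpace

variable {X : Type*} {H : Type*} [NormedAddCommGroup H] [InnerProductSpace ℝ H]
  [CompleteSpace H] [RKHS ℝ H X ℝ] [TopologicalSpace X] {K : C(X × X, ℝ)}
  [CompactSpace X] [MeasurableSpace X] [BorelSpace X] (μ : Measure X) [IsFiniteMeasure μ]

namespace IsNativeSpace

/-- Parseval in `V` for the projected kernel translate gives `∑ b_j(x)² = ‖Π k_x‖²`; integrating
over `x` yields the trace of `T_V`. -/
theorem hasSum_val_starProjection (hH : IsNativeSpace K H) (V : Submodule ℝ H) [CompleteSpace V]
    (B : SingularSystem (hH.toL2 μ ∘L V.subtypeL)) :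
    HasSum (fun j : RankIndex V => B.val j)
      (∫ x, ‖V.starProjection (kernelTranslate H x)‖ ^ 2 ∂μ) := by
  have hval : ∀ j : RankIndex V, ‖hH.toL2 μ (B.basis j : H)‖ ^ 2 = B.val j :=
    fun j => B.norm_sq_apply_basis j
  simp_rw [← hval]
  refine hH.hasSum_norm_sq_toL2 μ (fun x => ?_) ?_
  · let p : V := ⟨V.starProjection (kernelTranslate H x), V.starProjection_apply_mem _⟩
    have hp : ∀ v : V, inner ℝ v p = (v : H) x := fun v => by
      change inner ℝ (v : H) (V.starProjection (kernelTranslate H x)) = _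
      rw [← V.inner_starProjection_left_eq_right, V.starProjection_eq_self_iff.2 v.2,
        inner_kernelTranslate]
    have h := B.basis.hasSum_inner_mul_inner p p
    rw [real_inner_self_eq_norm_sq] at h
    convert! h using 2 with j
    rw [real_inner_comm, hp, sq]
  · simp_rw [hval]
    exact (B.summable_val ⟨_, (hH.hilbertSchmidtBound_toL2 μ).comp_subtypeL V⟩).subtype _

theorem hasSum_val (hH : IsNativeSpace K H) (B : SingularSystem (hH.toL2 μ)) :
    HasSum (fun j : RankIndex H => B.val j) (∫ x, ‖kernelTranslate H x‖ ^ 2 ∂μ) := by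
  simp_rw [← B.norm_sq_apply_basis]
  refine hH.hasSum_norm_sq_toL2 μ (fun x => ?_) ?_
  · have h := B.basis.hasSum_inner_mul_inner (kernelTranslate H x) (kernelTranslate H x)
    rw [real_inner_self_eq_norm_sq] at h
    convert! h using 2 with j
    rw [real_inner_comm, inner_kernelTranslate, sq]
  · simp_rw [B.norm_sq_apply_basis]
    exact (B.summable_val ⟨_, hH.hilbertSchmidtBound_toL2 μ⟩).subtype _

theorem lpNorm_powerFunction_of_span (hH : IsNativeSpace K H) {V : Submodule ℝ H} {n : ℕ}
    {u : Fin n → V} (hu : Orthonormal ℝ u) {U : Submodule ℝ H} [U.HasOrthogonalProjection]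
    (hU : (Submodule.span ℝ (Set.range u)).map V.subtype = U) :
    lpNorm (powerFunction U : X → ℝ) 2 μ = √(∫ x, ‖kernelTranslate H x‖ ^ 2 ∂μ
      - ∑ i, ‖(hH.toL2 μ ∘L V.subtypeL) (u i)‖ ^ 2) ∧
    ∑ i, ‖(hH.toL2 μ ∘L V.subtypeL) (u i)‖ ^ 2 ≤ ∫ x, ‖kernelTranslate H x‖ ^ 2 ∂μ := by
  have hu' : Orthonormal ℝ fun i => (u i : H) := hu.comp_linearIsometry V.subtypeₗᵢ
  have hU' : Submodule.span ℝ (Set.range fun i => (u i : H)) = U := by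
    rw [← hU, Submodule.map_span, ← Set.range_comp]
    rfl
  have h := hH.integral_norm_sq_starProjection_eq_sum μ hu' hU'
  change _ = ∑ i, ‖(hH.toL2 μ ∘L V.subtypeL) (u i)‖ ^ 2 at h
  rw [← h]
  exact ⟨hH.lpNorm_powerFunction μ U, hH.integral_norm_sq_starProjection_le μ U⟩

variable [FirstCountableTopology X]

/-- The correspondence is `φ = λ^(-1/2) A v` and `v = λ^(-1/2) A† φ`. Division is allowed because `n
≤ dim V` makes the first `n` values positive. -/
theorem isLeadingEigenspace_iff [μ.IsOpenPosMeasure] (hH : IsNativeSpace K H)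
    (V : ClosedSubmodule ℝ H) [CompleteSpace V.toSubmodule]
    {A : V.toSubmodule →L[ℝ] Lp ℝ 2 μ} (hA : A = hH.toL2 μ ∘L V.toSubmodule.subtypeL)
    (B : SingularSystem A) {n : ℕ}
    (hn : (n : Cardinal) ≤ Module.rank ℝ V.toSubmodule) (F : Submodule ℝ H) :
    IsLeadingEigenspace μ hH V n F ↔ ∃ v : Fin n → V.toSubmodule, Orthonormal ℝ v ∧
      (∀ i, A.adjoint (A (v i)) = B.val i • v i) ∧
      (Submodule.span ℝ (Set.range v)).map V.toSubmodule.subtype = F := by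
  have hT := hH.integralOperator_restrictedKernel_eq μ V
  have hA' : ∀ f : V.toSubmodule, A f = hH.toL2 μ f := fun f => hA ▸ rfl
  rw [← hA] at hT
  have hval : ∀ j, restrictedEigenvalue μ hH V j = B.val j := fun j => B.orderedEigenvalue_eq hT j
  have hpos : ∀ i : Fin n, 0 < B.val i := fun i =>
    B.pos ⟨i, lt_of_lt_of_le (by exact_mod_cast i.2) hn⟩
  have hsq : ∀ i : Fin n, √(B.val i) * √(B.val i) = B.val i := fun i =>
    Real.mul_self_sqrt (hpos i).le
  have hs0 : ∀ i : Fin n, √(B.val i) ≠ 0 := fun i => (Real.sqrt_pos.2 (hpos i)).ne'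
  constructor
  · rintro ⟨φ, u, hφ, hTφ, hφu, rfl⟩
    simp_rw [hT, hval] at hTφ
    have hAu : ∀ i, hH.toL2 μ (u i) = φ i := fun i =>
      Lp.ext ((hH.coeFn_toL2 μ (u i)).trans (hφu i).symm)
    have hφ' : ∀ i j, inner ℝ (φ i) (φ j) = if i = j then 1 else 0 := orthonormal_iff_ite.1 hφ
    -- The representative `u i` is only assumed to lie in `H`; injectivity of the embedding places
    -- it in `V`.
    have hAφ : ∀ i, ((A.adjoint (φ i) : V.toSubmodule) : H) = B.val i • u i := fun i => by
      refine hH.toL2_injective μ ?_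
      rw [map_smul, hAu, ← hA', hTφ]
    refine ⟨fun i => (√(B.val i))⁻¹ • A.adjoint (φ i), ?_, fun i => ?_, ?_⟩
    · rw [orthonormal_iff_ite]
      intro i j
      rw [real_inner_smul_left, real_inner_smul_right, A.adjoint_inner_left, hTφ,
        real_inner_smul_right, hφ']
      split_ifs with hij
      · subst hij
        have := hs0 i
        rw [mul_one, ← hsq i]
        field_simp
        simp
      · simp
    · rw [map_smul, map_smul, hTφ, map_smul, smul_comm]
    · rw [Submodule.map_span, ← Set.range_comp]
      congr 2
      funext i
      change (√(B.val i))⁻¹ • ((A.adjoint (φ i) : V.toSubmodule) : H) = _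
      rw [hAφ, hval, smul_smul]
      congr 1
      have := hs0 i
      nth_rw 2 [← hsq i]
      field_simp
  · rintro ⟨v, hv, hS, rfl⟩
    have hv' : ∀ i j, inner ℝ (v i) (v j) = if i = j then (1 : ℝ) else 0 := orthonormal_iff_ite.1 hv
    refine ⟨fun i => (√(B.val i))⁻¹ • A (v i), fun i => (√(B.val i))⁻¹ • (v i : H), ?_,
      fun i => ?_, fun i => ?_, ?_⟩
    · rw [orthonormal_iff_ite]
      intro i j
      rw [real_inner_smul_left, real_inner_smul_right, ← inner_adjoint_apply_self, hS,
        real_inner_smul_left, hv']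
      split_ifs with hij
      · subst hij
        have := hs0 i
        rw [mul_one, ← hsq i]
        field_simp
        simp
      · simp
    · rw [hT, hval, map_smul, map_smul, hS, map_smul, smul_comm]
    · have h := hH.coeFn_toL2 μ ((√(B.val i))⁻¹ • (v i : H))
      rw [map_smul, ← hA'] at h
      exact h
    · rw [Submodule.map_span, ← Set.range_comp]
      congr 2
      funext i
      change (v i : H) = √(restrictedEigenvalue μ hH V i) • (√(B.val i))⁻¹ • (v i : H)
      rw [hval, smul_smul, mul_inv_cancel₀ (hs0 i), one_smul]

end IsNativeSpace

end NativeSpace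

theorem exists_orthonormal_of_le {H : Type*} [NormedAddCommGroup H] [InnerProductSpace ℝ H]
    {U V : Submodule ℝ H} [FiniteDimensional ℝ U] (h : U ≤ V) {n : ℕ}
    (hn : Module.finrank ℝ U = n) :
    ∃ u : Fin n → V, Orthonormal ℝ u ∧ (Submodule.span ℝ (Set.range u)).map V.subtype = U := by
  subst hn
  let b := stdOrthonormalBasis ℝ U
  refine ⟨fun i => ⟨b i, h (b i).2⟩, ?_, ?_⟩
  · have hb : Orthonormal ℝ fun i => (b i : H) := b.orthonormal.comp_linearIsometry U.subtypeₗᵢ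
    exact hb
  · rw [Submodule.map_span, ← Set.range_comp]
    have h1 : Submodule.span ℝ (Set.range b) = ⊤ := by
      rw [← b.coe_toBasis]
      exact b.toBasis.span_eq
    have h2 := congrArg (Submodule.map U.subtype) h1
    rw [Submodule.map_span, ← Set.range_comp, Submodule.map_top, Submodule.range_subtype] at h2
    exact h2

end

/-! ### The optimality theorem. -/

theorem mainTheorem2 {d : ℕ} (Ω : Set (EuclideanSpace ℝ (Fin d))) [Nonempty Ω] [CompactSpace Ω]
    [(lebesgueOn Ω).IsOpenPosMeasure]
    (K : C(Ω × Ω, ℝ)) (hK : (Matrix.of fun x y : Ω => K (x, y)).PosDef)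
    {H : Type*} [NormedAddCommGroup H] [InnerProductSpace ℝ H] [CompleteSpace H] [RKHS ℝ H Ω ℝ]
    (hH : IsNativeSpace K H) (V : ClosedSubmodule ℝ H) :
    let lam : ℕ → ℝ := orderedEigenvalue (integralOperator (lebesgueOn Ω) K)
    let lamV : ℕ → ℝ := restrictedEigenvalue (lebesgueOn Ω) hH V
    Summable lam ∧ Summable lamV ∧
    (∀ n : ℕ, (n : Cardinal) ≤ Module.rank ℝ V.toSubmodule →
      ∑ j ∈ Finset.range n, lamV j ≤ ∑' j, lam j ∧
      -- the lower bound
      (∀ (Vn : Submodule ℝ H) [FiniteDimensional ℝ Vn],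
        Vn ≤ V.toSubmodule → Module.finrank ℝ Vn = n →
          MemLp (powerFunction Vn : Ω → ℝ) 2 (lebesgueOn Ω) ∧
          √((∑' j, lam j) - ∑ j ∈ Finset.range n, lamV j)
            ≤ lpNorm (powerFunction Vn : Ω → ℝ) 2 (lebesgueOn Ω)) ∧
      -- the spaces `E_{n,V}` exist and are `n`-dimensional subspaces of `V`
      (∃ E : Submodule ℝ H, IsLeadingEigenspace (lebesgueOn Ω) hH V n E) ∧
      (∀ E : Submodule ℝ H, IsLeadingEigenspace (lebesgueOn Ω) hH V n E →
        E ≤ V.toSubmodule ∧ Module.rank ℝ E = n) ∧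
      -- they are optimal, and nothing else is
      (∀ (Vn : Submodule ℝ H) [FiniteDimensional ℝ Vn],
        Vn ≤ V.toSubmodule → Module.finrank ℝ Vn = n →
          (lpNorm (powerFunction Vn : Ω → ℝ) 2 (lebesgueOn Ω)
              = √((∑' j, lam j) - ∑ j ∈ Finset.range n, lamV j) ↔
            IsLeadingEigenspace (lebesgueOn Ω) hH V n Vn)) ∧
      -- `E_{n,V}` is a single subspace unless the `n`-th eigenvalue is equal to the next one
      ((∀ m : ℕ, n = m + 1 → lamV n < lamV m) →
        ∃! E : Submodule ℝ H, IsLeadingEigenspace (lebesgueOn Ω) hH V n E)) ∧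
    -- the power function of `V` itself
    MemLp (powerFunction V.toSubmodule : Ω → ℝ) 2 (lebesgueOn Ω) ∧
    ∑' j : {j : ℕ // (j : Cardinal) < Module.rank ℝ V.toSubmodule}, lamV j ≤ ∑' j, lam j ∧
    lpNorm (powerFunction V.toSubmodule : Ω → ℝ) 2 (lebesgueOn Ω)
      = √((∑' j, lam j)
          - ∑' j : {j : ℕ // (j : Cardinal) < Module.rank ℝ V.toSubmodule}, lamV j) := by
  intro lam lamV
  set μ := lebesgueOn Ω with hμ
  have hcomp : CompleteSpace V.toSubmodule := V.isClosed.completeSpace_coe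
  obtain ⟨BH⟩ := exists_singularSystem (hH.toL2_injective μ) (hH.hilbertSchmidtBound_toL2 μ)
  have hHS := (hH.hilbertSchmidtBound_toL2 μ).comp_subtypeL V.toSubmodule
  obtain ⟨B⟩ := exists_singularSystem
    (A := hH.toL2 μ ∘L V.toSubmodule.subtypeL)
    ((hH.toL2_injective μ).comp Subtype.coe_injective) hHS
  have hlam : lam = BH.val := funext fun j =>
    BH.orderedEigenvalue_eq (hH.integralOperator_eq μ) j
  have hlamV : lamV = B.val := funext fun j =>
    B.orderedEigenvalue_eq (hH.integralOperator_restrictedKernel_eq μ V) j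
  have hVsum := B.summable_val ⟨_, hHS⟩
  have htr : ∑' j, lam j = ∫ x, ‖kernelTranslate H x‖ ^ 2 ∂μ := by
    rw [hlam, ← BH.tsum_rankIndex, (hH.hasSum_val μ BH).tsum_eq]
  have hV := hH.hasSum_val_starProjection μ V.toSubmodule B
  have hVtr := hH.integral_norm_sq_starProjection_le μ V.toSubmodule
  rw [htr, hlam, hlamV]
  refine ⟨BH.summable_val ⟨_, hH.hilbertSchmidtBound_toL2 μ⟩, hVsum, fun n hn => ?_,
    IsNativeSpace.memLp_of_continuous μ (hH.continuous_powerFunction _), ?_, ?_⟩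
  · have hle : ∑ j ∈ Finset.range n, B.val j ≤ ∫ x, ‖kernelTranslate H x‖ ^ 2 ∂μ := by
      rw [← hV.tsum_eq, B.tsum_rankIndex] at hVtr
      exact (hVsum.sum_le_tsum _ fun j _ => B.val_nonneg j).trans hVtr
    have hiff := hH.isLeadingEigenspace_iff μ V rfl B hn
    have hmem : ∀ i : Fin n, ((i : ℕ) : Cardinal) < Module.rank ℝ V.toSubmodule :=
      fun i => lt_of_lt_of_le (by exact_mod_cast i.2) hn
    have hex : ∃ F : Submodule ℝ H, IsLeadingEigenspace μ hH V n F :=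
      ⟨_, (hiff _).2 ⟨fun i => B.basis ⟨i, hmem i⟩,
        B.basis.orthonormal.comp (fun i : Fin n => (⟨i, hmem i⟩ : RankIndex V.toSubmodule))
          fun a b hab => by simpa [Fin.ext_iff] using hab,
        fun i => B.apply_basis _, rfl⟩⟩
    refine ⟨hle, ?_, hex, ?_, ?_, ?_⟩
    · intro Vn _ hVn hfr
      refine ⟨IsNativeSpace.memLp_of_continuous μ (hH.continuous_powerFunction _), ?_⟩
      obtain ⟨u, hu, hU⟩ := exists_orthonormal_of_le hVn hfr
      rw [(hH.lpNorm_powerFunction_of_span μ hu hU).1]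
      exact Real.sqrt_le_sqrt (sub_le_sub_left (B.sum_norm_sq_le hn hu) _)
    · intro F hF
      obtain ⟨v, hv, -, rfl⟩ := (hiff F).1 hF
      refine ⟨Submodule.map_subtype_le _ _, ?_⟩
      rw [Submodule.map_span, ← Set.range_comp]
      have hli := (hv.comp_linearIsometry V.toSubmodule.subtypeₗᵢ).linearIndependent
      have hfd : FiniteDimensional ℝ (Submodule.span ℝ (Set.range (V.toSubmodule.subtype ∘ v))) :=
        FiniteDimensional.span_of_finite ℝ (Set.finite_range _)
      rw [← Module.finrank_eq_rank]
      exact_mod_cast (finrank_span_eq_card hli).trans (Fintype.card_fin n)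
    · intro Vn _ hVn hfr
      constructor
      · intro heq
        obtain ⟨u, hu, hU⟩ := exists_orthonormal_of_le hVn hfr
        have hp := hH.lpNorm_powerFunction_of_span μ hu hU
        -- Both radicands are nonnegative, so equal roots give equality in Ky Fan's principle.
        rw [hp.1, Real.sqrt_inj (sub_nonneg.2 hp.2) (sub_nonneg.2 hle)] at heq
        have hfd : FiniteDimensional ℝ (Submodule.span ℝ (Set.range u)) :=
          FiniteDimensional.span_of_finite ℝ (Set.finite_range u)
        obtain ⟨v, hv, hvu, hS⟩ := B.exists_eigenvectors_of_sum_eq hn hu rfl (sub_right_inj.1 heq)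
        exact (hiff Vn).2 ⟨v, hv, hS, hvu ▸ hU⟩
      · intro hF
        obtain ⟨v, hv, hS, hvU⟩ := (hiff Vn).1 hF
        rw [(hH.lpNorm_powerFunction_of_span μ hv hvU).1, B.sum_norm_sq_of_eigenvectors hv hS]
    · intro hgap
      -- The gap is assumed only at `n - 1`; monotonicity extends it to smaller indices, and `n = 0`
      -- is vacuous.
      have hlt : ∀ i : Fin n, B.val n < B.val i := fun i => by
        obtain ⟨m, rfl⟩ := Nat.exists_eq_succ_of_ne_zero (Nat.ne_zero_of_lt i.2)
        exact (hgap m rfl).trans_le (B.antitone (Nat.lt_succ_iff.1 i.2))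
      obtain ⟨F, hF⟩ := hex
      refine ⟨F, hF, fun G hG => ?_⟩
      obtain ⟨v, hv, hS, rfl⟩ := (hiff F).1 hF
      obtain ⟨w, hw, hS', rfl⟩ := (hiff G).1 hG
      rw [B.span_eq_lead hv hS hlt, B.span_eq_lead hw hS' hlt]
  · rw [hV.tsum_eq]
    exact hVtr
  · rw [hV.tsum_eq]
    exact hH.lpNorm_powerFunction μ _
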